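/- Let $\mathcal N=\{1,\dots,n\}$ be a set of products, let $\mathcal S$ be a finite collection of assortments $S\subseteq\mathcal N$, and let $\boldsymbol p_{\mathcal S}=(p_{i,S}: i\in S,\ S\in\mathcal S)$ be choice data, i.e. $p_{i,S}\ge 0$ and $\sum_{i\in S}p_{i,S}=1$ for every $S\in\mathcal S$. Call $\boldsymbol p_{\mathcal S}$ representable by a marginal distribution model (MDM) if there are deterministic utilities $\nu_1,\dots,\nu_n\in\mathbb R$ and probability distributions $F_1,\dots,F_n$ on $\mathbb R$, each absolutely continuous, with distribution function strictly increasing on its support and with finite first absolute moment, such that for every $S\in\mathcal S$ there is a joint distribution $\theta^*$ of $(\tilde\epsilon_1,\dots,\tilde\epsilon_n)$ with marginals $F_1,\dots,F_n$ that maximizes $\mathbb E_{\tilde{\boldsymbol\epsilon}\sim\theta}\big[\max_{i\in S}(\nu_i+\tilde\epsilon_i)\big]$ over all joint distributions $\theta$ with these marginals, and for which $p_{i,S}=\mathbb P_{\theta^*}\big(i=\arg\max_{j\in S}(\nu_j+\tilde\epsilon_j)\big)$ for all $i\in S$. Then $\boldsymbol p_{\mathcal S}$ is representable by an MDM if and only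 if there exists a function $\lambda:\mathcal S\to\mathbb R$ such that for any two assortments $S,T\in\mathcal S$ containing a common product $i$: $$\lambda(S)>\lambda(T)\ \text{ if } p_{i,S}<p_{i,T},\qquad \lambda(S)=\lambda(T)\ \text{ if } p_{i,S}=p_{i,T}\neq 0.$$ As a result, whether $\boldsymbol p_{\mathcal S}$ is representable by an MDM can be checked by solving a linear program with $|\mathcal S|+1=\mathcal O(|\mathcal S|)$ continuous variables and at most $n|\mathcal S|$ constraints: $\boldsymbol p_{\mathcal S}$ is representable if and only if the optimal value of the following program is strictly positive. The variables are $\lambda_S$ $(S\in\mathcal S)$ and $\epsilon$; the objective is to maximize $\epsilon$. For each product $i$, list the assortments of $\mathcal S$ containing $i$ in non-increasing order of choice probability, $p_{i,S_1}\ge\dots\ge p_{i,S_l}>0=p_{i,S_{l+1}}=\dots=p_{i,S_m}$. If $l\ge1$, impose, for $1\le k<l$, the constraint $\lambda_{S_{k+1}}-\lambda_{S_k}\ge\epsilon$ if $p_{i,S_{k+1}}<p_{i,S_k}$ and $\lambda_{S_{k+1}}=\lambda_{S_k}$ if $p_{i,S_{k+1}}=p_{i,S_k}$, and, for $l<k\le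 m$, the constraint $\lambda_{S_k}-\lambda_{S_l}\ge\epsilon$. -/

import Mathlib

open MeasureTheory ProbabilityTheory

noncomputable section

/-! ## Choice data -/

/-- `p i S` is the fraction of the population choosing product `i` from the assortment `S`.
Only the values with `S ∈ 𝒮` and `i ∈ S` are data; the other values are never used. -/
def IsChoiceData {n : ℕ} (𝒮 : Finset (Finset (Fin n))) (p : Fin n → Finset (Fin n) → ℝ) : Prop :=
  ∀ S ∈ 𝒮, (∀ i ∈ S, 0 ≤ p i S) ∧ ∑ i ∈ S, p i S = 1

/-! ## The marginal distribution model -/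

/-- The standing assumption on the marginal law `μ` of a random utility term: it is an absolutely
continuous probability law, its distribution function is strictly increasing on its support, and
it has a finite first absolute moment. -/
structure IsAdmissibleMarginal (μ : Measure ℝ) : Prop where
  isProbabilityMeasure : IsProbabilityMeasure μ
  absolutelyContinuous : μ ≪ volume
  strictMonoOn_cdf : StrictMonoOn (cdf μ) μ.support
  integrable : Integrable (fun x : ℝ => x) μ

/-- The set of all joint laws of `(ε₁, …, εₙ)` with the given marginal laws `F₁, …, Fₙ`. -/
def jointLaws {n : ℕ} (F : Fin n → Measure ℝ) : Set (Measure (Fin n → ℝ)) :=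
  {θ | IsProbabilityMeasure θ ∧ ∀ i, θ.map (fun e => e i) = F i}

/-- The expected maximal utility `𝔼_θ [max_{i ∈ S} (νᵢ + εᵢ)]`. -/
def expectedMaxUtility {n : ℕ} (ν : Fin n → ℝ) (S : Finset (Fin n))
    (θ : Measure (Fin n → ℝ)) : ℝ :=
  ∫ e, ⨆ i : S, (ν i + e i) ∂θ

/-- The probability that `i` is the (unique) maximizer of `νⱼ + εⱼ` over `j ∈ S`. -/
def choiceProb {n : ℕ} (ν : Fin n → ℝ) (S : Finset (Fin n)) (θ : Measure (Fin n → ℝ))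
    (i : Fin n) : ℝ :=
  θ.real {e | ∀ j ∈ S, j ≠ i → ν j + e j < ν i + e i}

/-- The choice data are representable by a marginal distribution model: there are admissible
marginals and deterministic utilities, the same for all assortments, such that for each assortment
`S` of the collection the observed choice probabilities are those under a joint law `θ` that
maximizes the expected maximal utility over all joint laws with these marginals. -/
def MDMRepresentable {n : ℕ} (𝒮 : Finset (Finset (Fin n)))
    (p : Fin n → Finset (Fin n) → ℝ) : Prop :=
  ∃ (F : Fin n → Measure ℝ) (ν : Fin n → ℝ), (∀ i, IsAdmissibleMarginal (F i)) ∧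
    ∀ S ∈ 𝒮, ∃ θ ∈ jointLaws F, IsMaxOn (expectedMaxUtility ν S) (jointLaws F) θ ∧
      ∀ i ∈ S, p i S = choiceProb ν S θ i

/-! ## Linear programs -/

/-- A linear constraint in real variables indexed by `V`: `ge a b` is `∑ v, a v * x v ≥ b` and
`eq a b` is `∑ v, a v * x v = b`. -/
inductive LinearConstraint (V : Type) : Type
  | ge (a : V → ℝ) (b : ℝ) : LinearConstraint V
  | eq (a : V → ℝ) (b : ℝ) : LinearConstraint V

/-- The point `x` satisfies the constraint. -/
def LinearConstraint.Holds {V : Type} [Fintype V] (x : V → ℝ) : LinearConstraint V → Prop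
  | .ge a b => b ≤ ∑ v, a v * x v
  | .eq a b => ∑ v, a v * x v = b

/-- A linear program in real variables indexed by `V`: maximize `∑ v, objective v * x v` subject
to a finite list of constraints. -/
structure LinearProgram (V : Type) where
  objective : V → ℝ
  constraints : List (LinearConstraint V)

/-- The number of variables. -/
def LinearProgram.numVariables {V : Type} [Fintype V] (_P : LinearProgram V) : ℕ :=
  Fintype.card V

/-- The number of constraints. -/
def LinearProgram.numConstraints {V : Type} (P : LinearProgram V) : ℕ :=
  P.constraints.length

/-- The point `x` is feasible. -/
def LinearProgram.IsFeasible {V : Type} [Fintype V] (P : LinearProgram V) (x : V → ℝ) : Prop :=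
  ∀ c ∈ P.constraints, c.Holds x

/-- The optimal value (`⊥` if infeasible, `⊤` if unbounded). -/
def LinearProgram.optimalValue {V : Type} [Fintype V] (P : LinearProgram V) : EReal :=
  ⨆ (x : V → ℝ) (_ : P.IsFeasible x), ((∑ v, P.objective v * x v : ℝ) : EReal)

/-! ## The linear program that checks consistency with the marginal distribution model

Its variables are indexed by `Option 𝒮`: `some S` stands for `λ(S)`, and `none` for `ε`. -/

/-- The constraint `λ(S) - λ(T) - ε ≥ 0`. -/
def gapConstraint {n : ℕ} {𝒮 : Finset (Finset (Fin n))} (S T : 𝒮) :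
    LinearConstraint (Option 𝒮) :=
  .ge (Pi.single (some S) 1 - Pi.single (some T) 1 - Pi.single none 1) 0

/-- The constraint `λ(S) - λ(T) = 0`. -/
def tieConstraint {n : ℕ} {𝒮 : Finset (Finset (Fin n))} (S T : 𝒮) :
    LinearConstraint (Option 𝒮) :=
  .eq (Pi.single (some S) 1 - Pi.single (some T) 1) 0

/-- The assortments of `𝒮` that contain product `i`, listed in non-increasing order of `p i ·`
(by merge sort). -/
def sortedAssortments {n : ℕ} (𝒮 : Finset (Finset (Fin n))) (p : Fin n → Finset (Fin n) → ℝ)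
    (i : Fin n) : List 𝒮 :=
  (Finset.univ.filter (fun S : 𝒮 => i ∈ S.1)).toList.mergeSort
    (fun S T => decide (p i T.1 ≤ p i S.1))

/-- The constraints produced by running through the rest of a sorted list, where `R` is the last
assortment seen so far with `p i R ≠ 0`. One constraint is produced for each entry `T`. -/
def chainConstraints {n : ℕ} {𝒮 : Finset (Finset (Fin n))} (p : Fin n → Finset (Fin n) → ℝ)
    (i : Fin n) : 𝒮 → List 𝒮 → List (LinearConstraint (Option 𝒮))
  | _, [] => []
  | R, T :: L =>
    if p i T.1 = 0 then gapConstraint T R :: chainConstraints p i R L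
    else (if p i T.1 = p i R.1 then tieConstraint T R else gapConstraint T R) ::
      chainConstraints p i T L

/-- The constraints that product `i` contributes, from a list of assortments containing `i`, in
non-increasing order of `p i ·`. There are none if `p i ·` vanishes on all of them. -/
def productConstraints {n : ℕ} {𝒮 : Finset (Finset (Fin n))} (p : Fin n → Finset (Fin n) → ℝ)
    (i : Fin n) : List 𝒮 → List (LinearConstraint (Option 𝒮))
  | [] => []
  | R :: L => if p i R.1 = 0 then [] else chainConstraints p i R L

/-- Maximize `ε` subject to the constraints contributed by all the products. -/
def mdmProgram {n : ℕ} (𝒮 : Finset (Finset (Fin n))) (p : Fin n → Finset (Fin n) → ℝ) :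
    LinearProgram (Option 𝒮) where
  objective := Pi.single none 1
  constraints := (List.finRange n).flatMap
    (fun i => productConstraints p i (sortedAssortments 𝒮 p i))

end

/-! Write `u i = ν i + e i`. For every real `l`, `max u i ≤ l + ∑ max (u i - l) 0` over `S`, and the
expectation of the right side depends only on the marginals. If the tails `1 - F i (l - ν i)` sum to
one over `S`, some coupling has almost surely exactly one `u i` above `l`
(`exists_jointLaw_uniqueExceedance`). It attains the bound, and so must every optimal law, which
forces the same property (`uniqueExceedance_of_isMaxOn`). The choice probabilities are then exactly
these tails. Representability thus amounts to `p i S = 1 - F i (λ(S) - ν i)` with one threshold per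
assortment, and the order conditions express that each `F i` increases strictly where it lies in
`(0, 1)`.

Sufficiency: take `ν = 0` and interpolate `1 - p i S` at the points `λ(S)` by a piecewise linear
distribution function (`OrderCompatible.exists_marginal`). Necessity: a threshold may fail to exist
(singletons) or to be unique (probability one), so `λ(S)` is instead the rank, under inclusion, of
the set of low thresholds of `S`.

The linear program encodes the order conditions through neighbours in each sorted list; a strict
solution on a finite collection has a positive minimal gap, which serves as `ε`. -/

noncomputable section

/-! ## The linear program -/

/-- The ordinal condition linking the values `lam` to the choice data. -/
def OrderCompatible {n : ℕ} (𝒮 : Finset (Finset (Fin n))) (p : Fin n → Finset (Fin n) → ℝ)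
    (lam : 𝒮 → ℝ) : Prop :=
  ∀ (S T : 𝒮) (i : Fin n), i ∈ S.1 → i ∈ T.1 →
    (p i S.1 < p i T.1 → lam T < lam S) ∧ (p i S.1 = p i T.1 → p i S.1 ≠ 0 → lam S = lam T)

section LP

variable {n : ℕ} {𝒮 : Finset (Finset (Fin n))} {p : Fin n → Finset (Fin n) → ℝ} {i : Fin n}

theorem gapConstraint_holds_iff (S T : 𝒮) (x : Option 𝒮 → ℝ) :
    (gapConstraint S T).Holds x ↔ x (some T) + x none ≤ x (some S) := by
  simp only [gapConstraint, LinearConstraint.Holds, Pi.sub_apply, sub_mul, Finset.sum_sub_distrib,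
    Pi.single_apply, ite_mul, one_mul, zero_mul, Finset.sum_ite_eq', Finset.mem_univ, if_true]
  constructor <;> intro h <;> linarith

theorem tieConstraint_holds_iff (S T : 𝒮) (x : Option 𝒮 → ℝ) :
    (tieConstraint S T).Holds x ↔ x (some S) = x (some T) := by
  simp only [tieConstraint, LinearConstraint.Holds, Pi.sub_apply, sub_mul, Finset.sum_sub_distrib,
    Pi.single_apply, ite_mul, one_mul, zero_mul, Finset.sum_ite_eq', Finset.mem_univ, if_true]
  exact sub_eq_zero

theorem length_chainConstraints (R : 𝒮) (L : List 𝒮) :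
    (chainConstraints p i R L).length = L.length := by
  induction L generalizing R with
  | nil => rfl
  | cons T L ih => unfold chainConstraints; split <;> simp [ih]

theorem length_productConstraints_le (L : List 𝒮) :
    (productConstraints p i L).length ≤ L.length := by
  cases L with
  | nil => simp [productConstraints]
  | cons R L =>
    rw [productConstraints]
    split_ifs
    · simp
    · simp [length_chainConstraints]

theorem mem_sortedAssortments {S : 𝒮} : S ∈ sortedAssortments 𝒮 p i ↔ i ∈ S.1 := by
  simp [sortedAssortments]

theorem pairwise_sortedAssortments :
    (sortedAssortments 𝒮 p i).Pairwise (fun S T => p i T.1 ≤ p i S.1) := by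
  have h := List.pairwise_mergeSort (le := fun S T : 𝒮 => decide (p i T.1 ≤ p i S.1))
    (fun a b c h1 h2 => by simp only [decide_eq_true_eq] at *; exact h2.trans h1)
    (fun a b => by simpa using le_total _ _)
    (Finset.univ.filter (fun S : 𝒮 => i ∈ S.1)).toList
  simpa [sortedAssortments] using h

theorem length_sortedAssortments_le : (sortedAssortments 𝒮 p i).length ≤ 𝒮.card := by
  simp only [sortedAssortments, List.length_mergeSort, Finset.length_toList]
  exact (Finset.card_filter_le _ _).trans (by simp)

theorem numVariables_mdmProgram : (mdmProgram 𝒮 p).numVariables = 𝒮.card + 1 := by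
  simp [LinearProgram.numVariables]

theorem numConstraints_mdmProgram_le : (mdmProgram 𝒮 p).numConstraints ≤ n * 𝒮.card := by
  simp only [LinearProgram.numConstraints, mdmProgram, List.length_flatMap]
  refine (List.sum_le_card_nsmul _ 𝒮.card ?_).trans (by simp)
  simp only [List.mem_map, forall_exists_index, and_imp]
  rintro _ i - rfl
  exact (length_productConstraints_le _).trans length_sortedAssortments_le

/-- A point with the required gaps and ties satisfies the constraints of a sorted chain. -/
theorem holds_of_mem_chainConstraints {x : Option 𝒮 → ℝ} (hp : ∀ S : 𝒮, i ∈ S.1 → 0 ≤ p i S.1)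
    (hx : ∀ S T : 𝒮, i ∈ S.1 → i ∈ T.1 →
      (p i S.1 < p i T.1 → x (some T) + x none ≤ x (some S)) ∧
      (p i S.1 = p i T.1 → p i S.1 ≠ 0 → x (some S) = x (some T)))
    (R : 𝒮) (L : List 𝒮) (hR : i ∈ R.1) (hL : ∀ T ∈ L, i ∈ T.1) (h0 : p i R.1 ≠ 0)
    (hs : (R :: L).Pairwise (fun S T => p i T.1 ≤ p i S.1)) :
    ∀ c ∈ chainConstraints p i R L, c.Holds x := by
  induction L generalizing R with
  | nil => simp [chainConstraints]
  | cons T L ih =>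
    rw [List.pairwise_cons] at hs
    have hT : i ∈ T.1 := hL T (by simp)
    have hL' : ∀ U ∈ L, i ∈ U.1 := fun U hU => hL U (by simp [hU])
    have hTR : p i T.1 ≤ p i R.1 := hs.1 T (by simp)
    unfold chainConstraints
    split_ifs with h1 h2
    · intro c hc
      rcases List.mem_cons.1 hc with rfl | hc
      · rw [gapConstraint_holds_iff]
        exact (hx T R hT hR).1 (h1 ▸ lt_of_le_of_ne (hp R hR) h0.symm)
      · refine ih R hR hL' h0 ?_ c hc
        rw [List.pairwise_cons]
        exact ⟨fun U hU => hs.1 U (by simp [hU]), (List.pairwise_cons.1 hs.2).2⟩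
    · intro c hc
      rcases List.mem_cons.1 hc with rfl | hc
      · rw [tieConstraint_holds_iff]
        exact (hx T R hT hR).2 h2 h1
      · exact ih T hT hL' h1 hs.2 c hc
    · intro c hc
      rcases List.mem_cons.1 hc with rfl | hc
      · rw [gapConstraint_holds_iff]
        exact (hx T R hT hR).1 (lt_of_le_of_ne hTR h2)
      · exact ih T hT hL' h1 hs.2 c hc

/-- A chain of constraints determines the order of every later value relative to the first. -/
theorem head_of_chainConstraints {x : Option 𝒮 → ℝ} (hε : 0 < x none)
    (R : 𝒮) (L : List 𝒮) (h0 : p i R.1 ≠ 0)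
    (hs : (R :: L).Pairwise (fun S T => p i T.1 ≤ p i S.1))
    (hc : ∀ c ∈ chainConstraints p i R L, c.Holds x) :
    ∀ T ∈ L, (p i T.1 < p i R.1 → x (some R) < x (some T)) ∧
      (p i T.1 = p i R.1 → x (some T) = x (some R)) := by
  induction L generalizing R with
  | nil => simp
  | cons T L ih =>
    rw [List.pairwise_cons] at hs
    have hTR : p i T.1 ≤ p i R.1 := hs.1 T (by simp)
    unfold chainConstraints at hc
    split_ifs at hc with h1 h2
    · simp only [List.forall_mem_cons, gapConstraint_holds_iff] at hc ⊢
      refine ⟨⟨fun _ => by linarith [hc.1], fun h => absurd (h ▸ h1) h0⟩, ih R h0 ?_ hc.2⟩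
      rw [List.pairwise_cons]
      exact ⟨fun U hU => hs.1 U (by simp [hU]), (List.pairwise_cons.1 hs.2).2⟩
    · simp only [List.forall_mem_cons, tieConstraint_holds_iff] at hc ⊢
      have := ih T h1 hs.2 hc.2
      rw [h2, hc.1] at this
      exact ⟨⟨fun h => absurd h2 h.ne, fun _ => hc.1⟩, this⟩
    · simp only [List.forall_mem_cons, gapConstraint_holds_iff] at hc ⊢
      have hlt := lt_of_le_of_ne hTR h2
      refine ⟨⟨fun _ => by linarith [hc.1], fun h => absurd h h2⟩, fun U hU => ?_⟩
      have hUT : p i U.1 ≤ p i T.1 := (List.pairwise_cons.1 hs.2).1 U hU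
      refine ⟨fun _ => ?_, fun h => absurd (h ▸ hUT) (not_le.2 hlt)⟩
      rcases hUT.lt_or_eq with h | h
      · linarith [(ih T h1 hs.2 hc.2 U hU).1 h, hc.1]
      · linarith [(ih T h1 hs.2 hc.2 U hU).2 h, hc.1]

/-- Zero-probability assortments are compared only with the last positive one, never with each
other; hence the condition `p i S.1 ≠ 0` in the tie clause. -/
theorem pairwise_of_chainConstraints {x : Option 𝒮 → ℝ} (hε : 0 < x none)
    (R : 𝒮) (L : List 𝒮) (h0 : p i R.1 ≠ 0) (hL : ∀ T ∈ L, 0 ≤ p i T.1)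
    (hs : (R :: L).Pairwise (fun S T => p i T.1 ≤ p i S.1))
    (hc : ∀ c ∈ chainConstraints p i R L, c.Holds x) :
    (R :: L).Pairwise (fun S T => (p i T.1 < p i S.1 → x (some S) < x (some T)) ∧
      (p i T.1 = p i S.1 → p i S.1 ≠ 0 → x (some T) = x (some S))) := by
  induction L generalizing R with
  | nil => simp
  | cons T L ih =>
    have hhead := head_of_chainConstraints hε R (T :: L) h0 hs hc
    refine List.pairwise_cons.2 ⟨fun U hU => ⟨(hhead U hU).1, fun h _ => (hhead U hU).2 h⟩, ?_⟩
    have hL' : ∀ U ∈ L, 0 ≤ p i U.1 := fun U hU => hL U (by simp [hU])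
    rw [List.pairwise_cons] at hs
    unfold chainConstraints at hc
    by_cases h1 : p i T.1 = 0
    -- The chain goes on from `R`, so the induction hypothesis applies to the list with `T` removed.
    -- Everything after `T` also has probability zero, so `T` itself owes nothing to later entries.
    · rw [if_pos h1] at hc
      have hs' : (R :: L).Pairwise (fun S T => p i T.1 ≤ p i S.1) := by
        rw [List.pairwise_cons]
        exact ⟨fun U hU => hs.1 U (by simp [hU]), (List.pairwise_cons.1 hs.2).2⟩
      have hrec := ih R h0 hL' hs' (fun c h => hc c (by simp [h]))
      refine List.pairwise_cons.2 ⟨fun U hU => ⟨fun h => ?_, fun _ h => absurd h1 h⟩,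
        (List.pairwise_cons.1 hrec).2⟩
      exact absurd (hL' U hU) (not_le.2 (h1 ▸ h))
    · rw [if_neg h1] at hc
      exact ih T h1 hL' hs.2 (fun c h => hc c (by simp [h]))

theorem orderCompatible_of_isFeasible (hp : ∀ S : 𝒮, ∀ i ∈ S.1, 0 ≤ p i S.1)
    {x : Option 𝒮 → ℝ} (hx : (mdmProgram 𝒮 p).IsFeasible x) (hε : 0 < x none) :
    OrderCompatible 𝒮 p (fun S => x (some S)) := by
  intro S T i hS hT
  have hc : ∀ c ∈ productConstraints p i (sortedAssortments 𝒮 p i), c.Holds x := fun c hc =>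
    hx c (List.mem_flatMap.2 ⟨i, List.mem_finRange i, hc⟩)
  have hs := pairwise_sortedAssortments (𝒮 := 𝒮) (p := p) (i := i)
  have hmem : ∀ S : 𝒮, S ∈ sortedAssortments 𝒮 p i ↔ i ∈ S.1 := fun S => mem_sortedAssortments
  generalize sortedAssortments 𝒮 p i = L at hc hs hmem
  cases L with
  | nil => exact absurd ((hmem S).2 hS) (by simp)
  | cons R L =>
    rw [productConstraints] at hc
    have hnn : ∀ T ∈ R :: L, 0 ≤ p i T.1 := fun T hT => hp T i ((hmem T).1 hT)
    split_ifs at hc with h0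
    -- A product never chosen imposes no condition: nothing is strict, and ties at zero are exempt.
    · have hz : ∀ U ∈ R :: L, p i U.1 = 0 := by
        intro U hU
        rcases List.mem_cons.1 hU with rfl | hU'
        · exact h0
        · exact le_antisymm (h0 ▸ (List.pairwise_cons.1 hs).1 U hU') (hnn U hU)
      rw [hz S ((hmem S).2 hS), hz T ((hmem T).2 hT)]
      simp
    · have hpw := pairwise_of_chainConstraints hε R L h0
        (fun T hT => hnn T (by simp [hT])) hs hc
      -- `S` and `T` may occur in either order in the list, so the relation is symmetrized first.
      have hsym : (R :: L).Pairwise (fun S T =>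
          ((p i S.1 < p i T.1 → x (some T) < x (some S)) ∧
            (p i S.1 = p i T.1 → p i S.1 ≠ 0 → x (some S) = x (some T))) ∧
          ((p i T.1 < p i S.1 → x (some S) < x (some T)) ∧
            (p i T.1 = p i S.1 → p i T.1 ≠ 0 → x (some T) = x (some S)))) := by
        refine List.Pairwise.imp₂ (fun S T hle h => ?_) hs hpw
        exact ⟨⟨fun h' => absurd h' (not_lt.2 hle), fun e hne => (h.2 e.symm hne).symm⟩,
          ⟨h.1, fun e hne => h.2 e (e ▸ hne)⟩⟩
      exact (hsym.forall_of_forall_of_flip (fun _ _ => by simp)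
        (hsym.imp fun h => ⟨h.2, h.1⟩) ((hmem S).2 hS) ((hmem T).2 hT)).1

theorem isFeasible_of_gap (hp : ∀ S : 𝒮, ∀ i ∈ S.1, 0 ≤ p i S.1) {x : Option 𝒮 → ℝ}
    (hx : ∀ (S T : 𝒮) (i : Fin n), i ∈ S.1 → i ∈ T.1 →
      (p i S.1 < p i T.1 → x (some T) + x none ≤ x (some S)) ∧
      (p i S.1 = p i T.1 → p i S.1 ≠ 0 → x (some S) = x (some T))) :
    (mdmProgram 𝒮 p).IsFeasible x := by
  intro c hc
  obtain ⟨i, -, hc⟩ := List.mem_flatMap.1 hc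
  have hs := pairwise_sortedAssortments (𝒮 := 𝒮) (p := p) (i := i)
  have hmem : ∀ S : 𝒮, S ∈ sortedAssortments 𝒮 p i ↔ i ∈ S.1 := fun S => mem_sortedAssortments
  generalize sortedAssortments 𝒮 p i = L at hc hs hmem
  cases L with
  | nil => simp [productConstraints] at hc
  | cons R L =>
    rw [productConstraints] at hc
    split_ifs at hc with h0
    · simp at hc
    · exact holds_of_mem_chainConstraints (fun S => hp S i) (fun S T => hx S T i) R L
        ((hmem R).1 (by simp)) (fun T hT => (hmem T).1 (by simp [hT])) h0 hs c hc

theorem exists_orderCompatible_iff_optimalValue_pos (hp : IsChoiceData 𝒮 p) :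
    (∃ lam, OrderCompatible 𝒮 p lam) ↔ 0 < (mdmProgram 𝒮 p).optimalValue := by
  have hp' : ∀ S : 𝒮, ∀ i ∈ S.1, 0 ≤ p i S.1 := fun S => (hp S.1 S.2).1
  have hobj : ∀ x : Option 𝒮 → ℝ, ∑ v, (mdmProgram 𝒮 p).objective v * x v = x none := by
    intro x
    simp [mdmProgram, Pi.single_apply]
  simp only [LinearProgram.optimalValue, lt_iSup_iff, hobj, EReal.coe_pos]
  constructor
  · rintro ⟨lam, h⟩
    let P : Finset (𝒮 × 𝒮) := Finset.univ.filter (fun q => lam q.2 < lam q.1)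
    -- The least positive difference between values of `lam`; any positive number will do if `lam`
    -- is constant.
    obtain ⟨ε, hε, hεP⟩ : ∃ ε : ℝ, 0 < ε ∧ ∀ q ∈ P, ε ≤ lam q.1 - lam q.2 := by
      rcases P.eq_empty_or_nonempty with hP | hP
      · exact ⟨1, one_pos, by simp [hP]⟩
      · obtain ⟨q, hq, hmin⟩ := P.exists_min_image (fun q => lam q.1 - lam q.2) hP
        exact ⟨_, sub_pos.2 (Finset.mem_filter.1 hq).2, hmin⟩
    refine ⟨fun v => v.elim ε lam, isFeasible_of_gap hp' fun S T i hS hT => ⟨fun hlt => ?_,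
      fun e hne => (h S T i hS hT).2 e hne⟩, hε⟩
    have := hεP (S, T) (by simpa [P] using (h S T i hS hT).1 hlt)
    simp only [Option.elim] at this ⊢
    linarith
  · rintro ⟨x, hx, hε⟩
    exact ⟨_, orderCompatible_of_isFeasible hp' hx hε⟩

end LP

/-! ## Admissible marginals -/

/-- A law carried by a compact interval that charges each of its subintervals is admissible. -/
theorem isAdmissibleMarginal_of_Icc {μ : Measure ℝ} [IsProbabilityMeasure μ] {a b : ℝ}
    (hac : μ ≪ volume) (ha : μ (Set.Iio a) = 0) (hb : μ (Set.Ioi b) = 0)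
    (hpos : ∀ x y, a ≤ x → x < y → y ≤ b → 0 < μ (Set.Ioo x y)) : IsAdmissibleMarginal μ := by
  have hab : ∀ᵐ x ∂μ, x ∈ Set.Icc a b := by
    have h1 : ∀ᵐ x ∂μ, ¬ x < a := measure_eq_zero_iff_ae_notMem.1 ha
    have h2 : ∀ᵐ x ∂μ, ¬ b < x := measure_eq_zero_iff_ae_notMem.1 hb
    filter_upwards [h1, h2] with x h1 h2 using ⟨not_lt.1 h1, not_lt.1 h2⟩
  have hsupp : μ.support ⊆ Set.Icc a b := Measure.support_subset_of_isClosed isClosed_Icc hab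
  refine ⟨inferInstance, hac, fun x hx y hy hxy => ?_, ?_⟩
  · have := hpos x y (hsupp hx).1 hxy (hsupp hy).2
    rw [cdf_eq_real, cdf_eq_real, measureReal_def, measureReal_def,
      ENNReal.toReal_lt_toReal (measure_ne_top _ _) (measure_ne_top _ _)]
    have hdisj : Disjoint (Set.Iic x) (Set.Ioo x y) :=
      Set.disjoint_left.2 fun z hz hz' => not_lt.2 hz hz'.1
    calc μ (Set.Iic x) < μ (Set.Iic x) + μ (Set.Ioo x y) :=
          ENNReal.lt_add_right (measure_ne_top _ _) this.ne'
      _ = μ (Set.Iic x ∪ Set.Ioo x y) := (measure_union hdisj measurableSet_Ioo).symm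
      _ ≤ μ (Set.Iic y) := measure_mono (Set.union_subset (Set.Iic_subset_Iic.2 hxy.le)
          fun z hz => hz.2.le)
  · refine Integrable.of_bound (by fun_prop) (max |a| |b|) ?_
    filter_upwards [hab] with x hx using abs_le_max_abs_abs hx.1 hx.2

/-- The distribution function of an admissible law increases strictly to the right of a point at
which it lies in `(0, 1)`. -/
theorem IsAdmissibleMarginal.cdf_lt_cdf {μ : Measure ℝ} (h : IsAdmissibleMarginal μ) {x y : ℝ}
    (hxy : x < y) (h0 : 0 < cdf μ x) (h1 : cdf μ x < 1) : cdf μ x < cdf μ y := by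
  have := h.isProbabilityMeasure
  by_contra hle
  have heq : cdf μ x = cdf μ y := le_antisymm (monotone_cdf μ hxy.le) (not_lt.1 hle)
  have hcl : IsClosed μ.support := Measure.isClosed_support
  have hnull : ∀ s : Set ℝ, s ∩ μ.support = ∅ → μ s = 0 := fun s hs =>
    measure_mono_null (fun z hz hz' => Set.eq_empty_iff_forall_notMem.1 hs z ⟨hz, hz'⟩)
      (Measure.measure_compl_support (μ := μ))
  have hIic : (Set.Iic x ∩ μ.support).Nonempty := by
    by_contra hne
    have := hnull _ (Set.not_nonempty_iff_eq_empty.1 hne)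
    rw [cdf_eq_real, measureReal_def, this] at h0
    simp at h0
  have hIci : (Set.Ici y ∩ μ.support).Nonempty := by
    by_contra hne
    have h2 := hnull _ (Set.not_nonempty_iff_eq_empty.1 hne)
    have h3 : μ (Set.Iic y) = 1 := by
      rw [← prob_compl_eq_zero_iff measurableSet_Iic, Set.compl_Iic]
      exact measure_mono_null Set.Ioi_subset_Ici_self h2
    rw [heq, cdf_eq_real, measureReal_def, h3] at h1
    simp at h1
  -- The last support point up to `x` and the first from `y` on. No mass lies in `(a, x]` or `(y,
  -- b]`, so equal values at `x` and `y` would give equal values at `a` and `b`, against strict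
  -- monotonicity on the support.
  obtain ⟨a, ⟨hax, ha⟩, hamax⟩ : ∃ a, IsGreatest (Set.Iic x ∩ μ.support) a :=
    ⟨_, (isClosed_Iic.inter hcl).isGreatest_csSup hIic ⟨x, fun z hz => hz.1⟩⟩
  obtain ⟨b, ⟨hyb, hb⟩, hbmin⟩ : ∃ b, IsLeast (Set.Ici y ∩ μ.support) b :=
    ⟨_, (isClosed_Ici.inter hcl).isLeast_csInf hIci ⟨y, fun z hz => hz.1⟩⟩
  have hab : a < b := lt_of_le_of_lt hax (hxy.trans_le hyb)
  have hlt := h.strictMonoOn_cdf ha hb hab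
  have hcdf : ∀ u v, u ≤ v → μ (Set.Ioc u v) = 0 → cdf μ v ≤ cdf μ u := by
    intro u v huv h0
    rw [cdf_eq_real, cdf_eq_real, measureReal_def, measureReal_def]
    refine ENNReal.toReal_mono (measure_ne_top _ _) ?_
    rw [← Set.Iic_union_Ioc_eq_Iic huv]
    exact (measure_union_le _ _).trans (by rw [h0, add_zero])
  have e1 : cdf μ x ≤ cdf μ a := hcdf a x hax (hnull _ (Set.eq_empty_iff_forall_notMem.2
    fun z hz => not_lt.2 (hamax ⟨hz.1.2, hz.2⟩) hz.1.1))
  have e2 : cdf μ b ≤ cdf μ y := by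
    refine hcdf y b hyb ?_
    have hz : μ (Set.Ioo y b) = 0 := hnull _ (Set.eq_empty_iff_forall_notMem.2
      fun z hz => not_lt.2 (hbmin ⟨hz.1.1.le, hz.2⟩) hz.1.2)
    have hs : μ {b} = 0 := h.absolutelyContinuous (by simp)
    refine measure_mono_null (t := Set.Ioo y b ∪ {b}) (fun z hz => ?_) (measure_union_null hz hs)
    rcases hz.2.lt_or_eq with h | h
    · exact Or.inl ⟨hz.1, h⟩
    · exact Or.inr h
  linarith

/-- The distribution function of an admissible law is continuous. -/
theorem IsAdmissibleMarginal.continuous_cdf {μ : Measure ℝ} (h : IsAdmissibleMarginal μ) :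
    Continuous (cdf μ) := by
  have := h.isProbabilityMeasure
  refine continuous_iff_continuousAt.2 fun x => ?_
  rw [(monotone_cdf μ).continuousAt_iff_leftLim_eq_rightLim, (cdf μ).rightLim_eq]
  refine le_antisymm ((monotone_cdf μ).leftLim_le le_rfl) ?_
  have hs : μ {x} = 0 := h.absolutelyContinuous (by simp)
  rw [← measure_cdf μ, StieltjesFunction.measure_singleton, ENNReal.ofReal_eq_zero] at hs
  linarith

/-- The measure with constant density `c` on the interval `(u, v)`. -/
def slab (c u v : ℝ) : Measure ℝ := ENNReal.ofReal c • volume.restrict (Set.Ioo u v)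

theorem slab_absolutelyContinuous (c u v : ℝ) : slab c u v ≪ volume :=
  (Measure.absolutelyContinuous_of_le Measure.restrict_le_self).smul_left _

theorem slab_eq_zero {c u v : ℝ} {s : Set ℝ} (hs : MeasurableSet s)
    (h : Disjoint s (Set.Ioo u v)) : slab c u v s = 0 := by
  rw [slab, Measure.smul_apply, Measure.restrict_apply hs, h.inter_eq]
  simp

theorem slab_of_subset {c u v : ℝ} (hc : 0 ≤ c) {s : Set ℝ} (hs : MeasurableSet s)
    (h : Set.Ioo u v ⊆ s) : slab c u v s = ENNReal.ofReal (c * (v - u)) := by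
  rw [slab, Measure.smul_apply, Measure.restrict_apply hs, Set.inter_eq_right.2 h,
    Real.volume_Ioo, smul_eq_mul, ENNReal.ofReal_mul hc]

theorem slab_Ioo_pos {c u v x y : ℝ} (hc : 0 < c) (hux : u ≤ x) (hxy : x < y) (hyv : y ≤ v) :
    0 < slab c u v (Set.Ioo x y) := by
  rw [slab, Measure.smul_apply, Measure.restrict_apply measurableSet_Ioo,
    Set.inter_eq_left.2 (Set.Ioo_subset_Ioo hux hyv), Real.volume_Ioo, smul_eq_mul]
  exact ENNReal.mul_pos (by simpa using hc) (by simpa using hxy)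

/-- A strictly increasing function on a finite set of reals is interpolated by an absolutely
continuous measure that charges every subinterval of its convex support. -/
theorem exists_measure_Iic_eq (P : Finset ℝ) (hP : P.Nonempty) (G : ℝ → ℝ)
    (hG : StrictMonoOn G P) (h0 : ∀ x ∈ P, 0 ≤ G x) :
    ∃ (μ : Measure ℝ) (a : ℝ), ∃ b ∈ P, (∀ x ∈ P, x ≤ b) ∧ a ≤ b ∧ μ ≪ volume ∧
      μ (Set.Iio a) = 0 ∧ μ (Set.Ioi b) = 0 ∧ (∀ x ∈ P, μ (Set.Iic x) = ENNReal.ofReal (G x)) ∧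
      ∀ x y, a ≤ x → x < y → y ≤ b → 0 < μ (Set.Ioo x y) := by
  induction P using Finset.induction_on_max with
  | empty => exact absurd hP (by simp)
  | insert m P hm ih =>
    rcases P.eq_empty_or_nonempty with rfl | hPne
    · rcases (h0 m (by simp)).lt_or_eq with hpos | hz
      -- The mass `G m` at the first point is spread over an interval of length one; if it vanishes,
      -- the zero measure with `a = b = m` makes the positivity claim vacuous.
      · refine ⟨slab (G m) (m - 1) m, m - 1, m, by simp, by simp, by linarith,
          slab_absolutelyContinuous _ _ _, slab_eq_zero measurableSet_Iio ?_,
          slab_eq_zero measurableSet_Ioi ?_, ?_, fun x y => slab_Ioo_pos hpos⟩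
        · exact Set.disjoint_left.2 fun z hz hz' => lt_asymm hz hz'.1
        · exact Set.disjoint_left.2 fun z hz hz' => lt_asymm hz hz'.2
        · intro x hx
          obtain rfl : x = m := by simpa using hx
          rw [slab_of_subset hpos.le measurableSet_Iic fun z hz => hz.2.le]
          congr 1
          ring
      · refine ⟨0, m, m, by simp, by simp, le_rfl, ?_, by simp, by simp, by simp [← hz], ?_⟩
        · exact Measure.AbsolutelyContinuous.zero _
        · intro x y h1 h2 h3; linarith
    · obtain ⟨μ, a, b, hbP, hb, hab, hac, ha, hb', hμ, hpos⟩ := ih hPne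
        (hG.mono (by simp)) (fun x hx => h0 x (by simp [hx]))
      have hbm : b < m := hm b hbP
      have hGbm : G b < G m := hG (by simp [hbP]) (by simp) hbm
      -- This density puts the increment `G m - G b` on the new gap `(b, m)`.
      have hc : 0 < (G m - G b) / (m - b) := div_pos (by linarith) (by linarith)
      refine ⟨μ + slab ((G m - G b) / (m - b)) b m, a, m, by simp, ?_, by linarith,
        hac.add_left (slab_absolutelyContinuous _ _ _), ?_, ?_, ?_, ?_⟩
      · intro x hx
        rcases Finset.mem_insert.1 hx with rfl | hx
        · exact le_rfl
        · exact (hm x hx).le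
      · rw [Measure.add_apply, ha, slab_eq_zero measurableSet_Iio, add_zero]
        exact Set.disjoint_left.2 fun z hz hz' => lt_asymm (hz.trans_le hab) hz'.1
      · rw [Measure.add_apply, measure_mono_null (Set.Ioi_subset_Ioi hbm.le) hb',
          slab_eq_zero measurableSet_Ioi, add_zero]
        exact Set.disjoint_left.2 fun z hz hz' => lt_asymm hz hz'.2
      · intro x hx
        rw [Measure.add_apply]
        rcases Finset.mem_insert.1 hx with rfl | hx
        · have hxb : μ (Set.Iic x) = μ (Set.Iic b) := by
            refine le_antisymm ?_ (measure_mono (Set.Iic_subset_Iic.2 hbm.le))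
            refine ((measure_mono fun z _ => ?_).trans
              (measure_union_le (Set.Iic b) (Set.Ioi b))).trans (by rw [hb', add_zero])
            exact le_or_gt z b
          rw [hxb, hμ b hbP, slab_of_subset hc.le measurableSet_Iic fun z hz => hz.2.le,
            div_mul_cancel₀ _ (by linarith), ← ENNReal.ofReal_add (h0 b (by simp [hbP]))
            (by linarith)]
          congr 1
          ring
        · rw [hμ x hx, slab_eq_zero measurableSet_Iic, add_zero]
          exact Set.disjoint_left.2 fun z hz hz' => not_lt.2 (le_trans hz (hb x hx)) hz'.1
      · intro x y hax hxy hym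
        rw [Measure.add_apply]
        rcases lt_or_ge x b with hxb | hbx
        · refine (lt_of_lt_of_le (hpos x (min y b) hax (lt_min hxy hxb) (min_le_right _ _))
            (measure_mono (Set.Ioo_subset_Ioo_right (min_le_left _ _)))).trans_le le_self_add
        · exact (slab_Ioo_pos hc hbx hxy hym).trans_le le_add_self

/-- A strictly increasing function on a finite set of reals with values in `[0, 1]` is interpolated
by the distribution function of an admissible law. -/
theorem exists_isAdmissibleMarginal_cdf_eq (P : Finset ℝ) (G : ℝ → ℝ)
    (hG : StrictMonoOn G P) (h0 : ∀ x ∈ P, 0 ≤ G x) {b : ℝ} (hbP : b ∈ P) (hb : G b = 1)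
    (hle : ∀ x ∈ P, x ≤ b) :
    ∃ μ : Measure ℝ, IsAdmissibleMarginal μ ∧ ∀ x ∈ P, cdf μ x = G x := by
  obtain ⟨μ, a, b', hb'P, hb', hab, hac, ha, hIoi, hμ, hpos⟩ :=
    exists_measure_Iic_eq P ⟨b, hbP⟩ G hG h0
  obtain rfl : b' = b := le_antisymm (hle b' hb'P) (hb' b hbP)
  have : IsProbabilityMeasure μ := by
    constructor
    rw [← Set.Iic_union_Ioi (a := b'), measure_union (Set.Iic_disjoint_Ioi le_rfl)
      measurableSet_Ioi, hIoi, hμ b' hbP, hb]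
    simp
  refine ⟨μ, isAdmissibleMarginal_of_Icc hac ha hIoi hpos, fun x hx => ?_⟩
  rw [cdf_eq_real, measureReal_def, hμ x hx, ENNReal.toReal_ofReal (h0 x hx)]

/-! ## Duality -/

/-- Exactly one coordinate `i ∈ S` of `e` exceeds its threshold `t i`. -/
def UniqueExceedance {n : ℕ} (S : Finset (Fin n)) (t e : Fin n → ℝ) : Prop :=
  ∃ i ∈ S, t i < e i ∧ ∀ j ∈ S, j ≠ i → e j ≤ t j

/-! ### Coupling with exactly one exceedance -/

section Coupling

variable {n : ℕ} {F : Fin n → Measure ℝ} {S : Finset (Fin n)} {t : Fin n → ℝ}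

/-- The laws of the coordinates, given that `i` is the coordinate exceeding its threshold. -/
def conditionedMarginal (F : Fin n → Measure ℝ) (S : Finset (Fin n)) (t : Fin n → ℝ)
    (i j : Fin n) : Measure ℝ :=
  if j ∈ S then (if j = i then (F j)[|Set.Ioi (t j)] else (F j)[|Set.Iic (t j)]) else F j

/-- The conditioning events have positive mass: if another coordinate `j` always exceeded its
threshold, its tail and that of `i` would sum to more than one. -/
theorem isProbabilityMeasure_conditionedMarginal [∀ i, IsProbabilityMeasure (F i)]
    (hsum : ∑ i ∈ S, F i (Set.Ioi (t i)) = 1) {i : Fin n} (hi : i ∈ S)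
    (h0 : F i (Set.Ioi (t i)) ≠ 0) (j : Fin n) :
    IsProbabilityMeasure (conditionedMarginal F S t i j) := by
  unfold conditionedMarginal
  split_ifs with hj hji
  · exact cond_isProbabilityMeasure (hji ▸ h0)
  · refine cond_isProbabilityMeasure fun hz => ?_
    have h1 : F j (Set.Ioi (t j)) = 1 := by
      rw [← Set.compl_Iic, prob_compl_eq_one_iff measurableSet_Iic, hz]
    have h2 : F i (Set.Ioi (t i)) + F j (Set.Ioi (t j)) ≤ 1 := by
      rw [← hsum, ← Finset.sum_pair (Ne.symm hji) (f := fun i => F i (Set.Ioi (t i)))]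
      exact Finset.sum_le_sum_of_subset (by simp [Finset.insert_subset_iff, hi, hj])
    rw [h1, add_comm] at h2
    exact absurd h2 (not_le.2 (ENNReal.lt_add_right ENNReal.one_ne_top h0))
  · infer_instance

/-- Law of total probability. For `j ∈ S`, the indices other than `j` carry total weight one minus
the tail of `j`, which is the mass of `Set.Iic (t j)`. -/
theorem sum_mul_conditionedMarginal [∀ i, IsProbabilityMeasure (F i)]
    (hsum : ∑ i ∈ S, F i (Set.Ioi (t i)) = 1) (j : Fin n) {s : Set ℝ} :
    ∑ i ∈ S, F i (Set.Ioi (t i)) * conditionedMarginal F S t i j s = F j s := by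
  unfold conditionedMarginal
  by_cases hj : j ∈ S
  · have hrest : ∑ i ∈ S.erase j, F i (Set.Ioi (t i)) = F j (Set.Iic (t j)) := by
      have h1 := Finset.add_sum_erase S (fun i => F i (Set.Ioi (t i))) hj
      have h2 := prob_add_prob_compl (μ := F j) (measurableSet_Ioi (a := t j))
      rw [hsum, ← h2, Set.compl_Ioi] at h1
      exact (ENNReal.add_right_inj (measure_ne_top _ _)).1 h1
    have hother : ∀ i ∈ S.erase j, F i (Set.Ioi (t i)) *
        (if j ∈ S then (if j = i then (F j)[|Set.Ioi (t j)] else (F j)[|Set.Iic (t j)])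
          else F j) s = F i (Set.Ioi (t i)) * (F j)[|Set.Iic (t j)] s := by
      intro i hi
      rw [if_pos hj, if_neg (Finset.ne_of_mem_erase hi).symm]
    rw [← Finset.add_sum_erase S _ hj, Finset.sum_congr rfl hother, ← Finset.sum_mul, hrest,
      if_pos hj, if_pos rfl, mul_comm, cond_mul_eq_inter measurableSet_Ioi, mul_comm,
      cond_mul_eq_inter measurableSet_Iic, Set.inter_comm, Set.inter_comm _ s,
      ← Set.compl_Ioi, ← Set.sdiff_eq, measure_inter_add_sdiff s measurableSet_Ioi]
  · simp only [if_neg hj, ← Finset.sum_mul, hsum, one_mul]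

/-- If the tail probabilities sum to one, then some joint law almost surely has exactly one
coordinate exceeding its threshold. -/
theorem exists_jointLaw_uniqueExceedance [∀ i, IsProbabilityMeasure (F i)]
    (hsum : ∑ i ∈ S, F i (Set.Ioi (t i)) = 1) :
    ∃ θ ∈ jointLaws F, ∀ᵐ e ∂θ, UniqueExceedance S t e := by
  -- Draw the exceeding index with its tail probability, then the coordinates independently from the
  -- conditioned laws. Components of weight zero need not be probability measures, whence the case
  -- splits on `h0`.
  let θ : Measure (Fin n → ℝ) :=
    ∑ i ∈ S, F i (Set.Ioi (t i)) • Measure.pi (conditionedMarginal F S t i)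
  have hprob : ∀ i ∈ S, F i (Set.Ioi (t i)) ≠ 0 → ∀ j,
    IsProbabilityMeasure (conditionedMarginal F S t i j) := fun i hi h0 j =>
      isProbabilityMeasure_conditionedMarginal hsum hi h0 j
  have happ : ∀ s, θ s =
      ∑ i ∈ S, F i (Set.Ioi (t i)) * Measure.pi (conditionedMarginal F S t i) s := fun s => by
    simp [θ, Measure.finsetSum_apply]
  refine ⟨θ, ⟨⟨?_⟩, fun j => ?_⟩, ?_⟩
  · rw [happ, ← hsum]
    refine Finset.sum_congr rfl fun i hi => ?_
    by_cases h0 : F i (Set.Ioi (t i)) = 0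
    · rw [h0, zero_mul]
    · have := hprob i hi h0
      rw [measure_univ, mul_one]
  · ext s hs
    rw [Measure.map_apply (measurable_pi_apply j) hs, happ,
      ← sum_mul_conditionedMarginal hsum j]
    refine Finset.sum_congr rfl fun i hi => ?_
    by_cases h0 : F i (Set.Ioi (t i)) = 0
    · rw [h0, zero_mul, zero_mul]
    · have := hprob i hi h0
      rw [← (measurePreserving_eval (conditionedMarginal F S t i) j).measure_preimage
        hs.nullMeasurableSet]
  · rw [ae_iff, happ]
    refine Finset.sum_eq_zero fun i hi => ?_
    by_cases h0 : F i (Set.Ioi (t i)) = 0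
    · rw [h0, zero_mul]
    · have := hprob i hi h0
      have hae : ∀ j ∈ S, ∀ᵐ e ∂Measure.pi (conditionedMarginal F S t i),
          (j = i → t j < e j) ∧ (j ≠ i → e j ≤ t j) := by
        intro j hj
        refine (Measure.tendsto_eval_ae_ae (μ := conditionedMarginal F S t i)
          (i := j)).eventually (p := fun x => (j = i → t j < x) ∧ (j ≠ i → x ≤ t j)) ?_
        unfold conditionedMarginal
        rw [if_pos hj]
        split_ifs with hji
        · filter_upwards [ae_cond_mem (μ := F j) (measurableSet_Ioi (a := t j))] with x hx
          exact ⟨fun _ => hx, fun h => absurd hji h⟩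
        · filter_upwards [ae_cond_mem (μ := F j) (measurableSet_Iic (a := t j))] with x hx
          exact ⟨fun h => absurd h hji, fun _ => hx⟩
      have hall := (Filter.eventually_all_finset S).2 hae
      have hu : ∀ᵐ e ∂Measure.pi (conditionedMarginal F S t i), UniqueExceedance S t e :=
        hall.mono fun e he => ⟨i, hi, (he i hi).1 rfl, fun j hj hji => (he j hj).2 hji⟩
      rw [ae_iff.1 hu, mul_zero]

end Coupling

/-! ### Weak duality and complementary slackness -/

section Dual

variable {n : ℕ} {F : Fin n → Measure ℝ} {ν : Fin n → ℝ} {S : Finset (Fin n)} {l : ℝ}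
  {θ : Measure (Fin n → ℝ)}

theorem measure_preimage_of_mem_jointLaws (hθ : θ ∈ jointLaws F) (i : Fin n) {s : Set ℝ}
    (hs : MeasurableSet s) : θ {e | e i ∈ s} = F i s := by
  rw [← hθ.2 i, Measure.map_apply (measurable_pi_apply i) hs]
  rfl

/-- The choice probabilities are tail probabilities when exactly one utility exceeds `l`. -/
theorem choiceProb_eq_of_uniqueExceedance (hθ : θ ∈ jointLaws F)
    [∀ i, IsProbabilityMeasure (F i)]
    (hu : ∀ᵐ e ∂θ, UniqueExceedance S (fun i => l - ν i) e) {i : Fin n} (hi : i ∈ S) :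
    choiceProb ν S θ i = 1 - cdf (F i) (l - ν i) := by
  have hae : {e : Fin n → ℝ | ∀ j ∈ S, j ≠ i → ν j + e j < ν i + e i} =ᵐ[θ]
      {e | e i ∈ Set.Ioi (l - ν i)} := by
    refine Filter.eventuallyEq_set.2 (hu.mono fun e he => ?_)
    obtain ⟨k, hk, hlt, hle⟩ := he
    simp only [Set.mem_ofPred_eq, Set.mem_Ioi]
    constructor
    · intro h
      by_cases hki : k = i
      · exact hki ▸ hlt
      · have := h k hk hki
        have := hle i hi (Ne.symm hki)
        linarith
    · intro h j hj hji
      obtain rfl : i = k := by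
        by_contra hne
        exact not_lt.2 (hle i hi hne) h
      have := hle j hj hji
      linarith
  rw [choiceProb, measureReal_congr hae, measureReal_def,
    measure_preimage_of_mem_jointLaws hθ i measurableSet_Ioi, ← measureReal_def, cdf_eq_real,
    ← Set.compl_Iic, probReal_compl_eq_one_sub measurableSet_Iic]

/-- The dual objective at the threshold `l`, as a random variable. -/
def dualUtility (ν : Fin n → ℝ) (S : Finset (Fin n)) (l : ℝ) (e : Fin n → ℝ) : ℝ :=
  l + ∑ i ∈ S, max (ν i + e i - l) 0

theorem iSup_le_dualUtility (hS : S.Nonempty) (e : Fin n → ℝ) :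
    ⨆ i : S, (ν i + e i) ≤ dualUtility ν S l e := by
  have := hS.to_subtype
  refine ciSup_le fun i => ?_
  have h1 : max (ν i + e i - l) 0 ≤ ∑ i ∈ S, max (ν i + e i - l) 0 :=
    Finset.single_le_sum (f := fun i => max (ν i + e i - l) 0) (fun _ _ => le_max_right _ _) i.2
  have := le_max_left (ν i + e i - l) 0
  unfold dualUtility
  linarith

theorem iSup_eq_dualUtility {e : Fin n → ℝ}
    (h : UniqueExceedance S (fun i => l - ν i) e) :
    ⨆ i : S, (ν i + e i) = dualUtility ν S l e := by
  obtain ⟨i, hi, hlt, hle⟩ := h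
  refine le_antisymm (iSup_le_dualUtility ⟨i, hi⟩ e) ?_
  have hsum : ∑ j ∈ S, max (ν j + e j - l) 0 = max (ν i + e i - l) 0 :=
    Finset.sum_eq_single_of_mem i hi fun j hj hji =>
      max_eq_right (by linarith [hle j hj hji])
  have h2 := le_ciSup (f := fun i : S => ν i + e i) (Set.finite_range _).bddAbove ⟨i, hi⟩
  rw [dualUtility, hsum, max_eq_left (by linarith)]
  simpa using h2

/-- With two utilities above `l`, some maximizer `k` is accompanied by another index `m` above `l`,
and the excess of `m` makes the dual bound strict. -/
theorem eq_of_iSup_eq_dualUtility {e : Fin n → ℝ}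
    (h : ⨆ i : S, (ν i + e i) = dualUtility ν S l e) {i j : Fin n} (hi : i ∈ S) (hj : j ∈ S)
    (hie : l - ν i < e i) (hje : l - ν j < e j) : i = j := by
  by_contra hij
  have : Nonempty S := ⟨⟨i, hi⟩⟩
  obtain ⟨k, hk⟩ := exists_eq_ciSup_of_finite (f := fun i : S => ν i + e i)
  obtain ⟨m, hm, hmk, hme⟩ : ∃ m ∈ S, m ≠ k ∧ l - ν m < e m := by
    by_cases hik : i = k
    · exact ⟨j, hj, fun h => hij (hik.trans h.symm), hje⟩
    · exact ⟨i, hi, hik, hie⟩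
  have hpair : ∑ i ∈ {m, k.1}, max (ν i + e i - l) 0 ≤ ∑ i ∈ S, max (ν i + e i - l) 0 :=
    Finset.sum_le_sum_of_subset_of_nonneg (by simp [Finset.insert_subset_iff, hm])
      (fun _ _ _ => le_max_right _ _)
  rw [Finset.sum_pair hmk] at hpair
  have h1 := le_max_left (ν k + e k - l) 0
  have h2 := le_max_left (ν m + e m - l) 0
  rw [← hk, dualUtility] at h
  linarith

theorem integrable_coord (hF : ∀ i, IsAdmissibleMarginal (F i)) (hθ : θ ∈ jointLaws F)
    (i : Fin n) : Integrable (fun e => e i) θ := by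
  have h := (hF i).integrable
  rw [← hθ.2 i] at h
  exact h.comp_measurable (measurable_pi_apply i)

theorem integrable_utility (hF : ∀ i, IsAdmissibleMarginal (F i)) (hθ : θ ∈ jointLaws F)
    (i : Fin n) : Integrable (fun e => ν i + e i) θ := by
  have := hθ.1
  exact (integrable_const _).add (integrable_coord hF hθ i)

theorem integrable_excess (hF : ∀ i, IsAdmissibleMarginal (F i)) (hθ : θ ∈ jointLaws F)
    (i : Fin n) : Integrable (fun e => max (ν i + e i - l) 0) θ := by
  have := hθ.1
  exact ((integrable_utility hF hθ i).sub (integrable_const l)).pos_part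

theorem integrable_dualUtility (hF : ∀ i, IsAdmissibleMarginal (F i)) (hθ : θ ∈ jointLaws F) :
    Integrable (dualUtility ν S l) θ := by
  have := hθ.1
  refine (integrable_const l).add (integrable_finsetSum _ fun i _ =>
    integrable_excess hF hθ i)

theorem integrable_iSup (hF : ∀ i, IsAdmissibleMarginal (F i)) (hθ : θ ∈ jointLaws F)
    (hS : S.Nonempty) : Integrable (fun e => ⨆ i : S, (ν i + e i)) θ := by
  have := hθ.1
  have := hS.to_subtype
  have hi := fun i => integrable_utility (ν := ν) hF hθ i
  refine (integrable_finsetSum S fun i _ => (hi i).abs).mono' ?_ (ae_of_all _ fun e => ?_)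
  · exact (Measurable.iSup fun i : S => by fun_prop).aestronglyMeasurable
  · obtain ⟨k, hk⟩ := exists_eq_ciSup_of_finite (f := fun i : S => ν i + e i)
    rw [← hk]
    exact Finset.single_le_sum (f := fun i => |ν i + e i|) (fun _ _ => abs_nonneg _) k.2

theorem integral_dualUtility (hF : ∀ i, IsAdmissibleMarginal (F i)) (hθ : θ ∈ jointLaws F) :
    ∫ e, dualUtility ν S l e ∂θ = l + ∑ i ∈ S, ∫ x, max (ν i + x - l) 0 ∂F i := by
  have := hθ.1
  have hint : ∀ i, Integrable (fun e : Fin n → ℝ => max (ν i + e i - l) 0) θ :=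
    integrable_excess hF hθ
  unfold dualUtility
  rw [integral_add (integrable_const l) (integrable_finsetSum _ fun i _ => hint i),
    integral_finsetSum _ fun i _ => hint i]
  simp only [integral_const, probReal_univ, one_smul]
  congr 1
  refine Finset.sum_congr rfl fun i _ => ?_
  rw [← hθ.2 i, integral_map (measurable_pi_apply i).aemeasurable
    (by fun_prop : Continuous fun x : ℝ => max (ν i + x - l) 0).aestronglyMeasurable]

/-- A joint law under which almost surely exactly one utility exceeds `l` is optimal. -/
theorem isMaxOn_of_uniqueExceedance (hF : ∀ i, IsAdmissibleMarginal (F i)) (hS : S.Nonempty)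
    (hθ : θ ∈ jointLaws F) (hu : ∀ᵐ e ∂θ, UniqueExceedance S (fun i => l - ν i) e) :
    IsMaxOn (expectedMaxUtility ν S) (jointLaws F) θ := by
  intro θ' hθ'
  calc expectedMaxUtility ν S θ' ≤ ∫ e, dualUtility ν S l e ∂θ' :=
        integral_mono (integrable_iSup hF hθ' hS) (integrable_dualUtility hF hθ')
          (iSup_le_dualUtility hS)
    _ = ∫ e, dualUtility ν S l e ∂θ := by
        rw [integral_dualUtility hF hθ', integral_dualUtility hF hθ]
    _ = expectedMaxUtility ν S θ :=
        integral_congr_ae (hu.mono fun e he => (iSup_eq_dualUtility he).symm)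

theorem sum_measure_Ioi_eq_one [∀ i, IsProbabilityMeasure (F i)] {t : Fin n → ℝ}
    (hsum : ∑ i ∈ S, (1 - cdf (F i) (t i)) = 1) : ∑ i ∈ S, F i (Set.Ioi (t i)) = 1 := by
  have h : ∀ i, F i (Set.Ioi (t i)) = ENNReal.ofReal (1 - cdf (F i) (t i)) := fun i => by
    rw [cdf_eq_real, ← probReal_compl_eq_one_sub measurableSet_Iic, Set.compl_Iic,
      ofReal_measureReal]
  simp only [h]
  rw [← ENNReal.ofReal_sum_of_nonneg fun i _ => sub_nonneg.2 (cdf_le_one _ _), hsum,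
    ENNReal.ofReal_one]

/-- If `l` is a critical point of the dual problem, then under every optimal joint law almost
surely exactly one utility exceeds `l`. -/
theorem uniqueExceedance_of_isMaxOn (hF : ∀ i, IsAdmissibleMarginal (F i))
    (hsum : ∑ i ∈ S, (1 - cdf (F i) (l - ν i)) = 1)
    (hθ : θ ∈ jointLaws F) (hmax : IsMaxOn (expectedMaxUtility ν S) (jointLaws F) θ) :
    ∀ᵐ e ∂θ, UniqueExceedance S (fun i => l - ν i) e := by
  have := fun i => (hF i).isProbabilityMeasure
  have := hθ.1
  have hS : S.Nonempty := by
    rw [Finset.nonempty_iff_ne_empty]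
    rintro rfl
    simp at hsum
  have htail := sum_measure_Ioi_eq_one (t := fun i => l - ν i) hsum
  obtain ⟨θ', hθ', hu⟩ := exists_jointLaw_uniqueExceedance htail
  -- The coupling `θ'` attains the dual value, which is the same for all joint laws; the optimal `θ`
  -- therefore attains it too.
  have hge : ∫ e, dualUtility ν S l e ∂θ ≤ ∫ e, ⨆ i : S, (ν i + e i) ∂θ := by
    refine le_trans (le_of_eq ?_) (hmax hθ')
    rw [integral_dualUtility hF hθ, ← integral_dualUtility hF hθ']
    exact integral_congr_ae (hu.mono fun e he => (iSup_eq_dualUtility he).symm)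
  have heq := integral_mono (μ := θ) (integrable_iSup hF hθ hS)
    (integrable_dualUtility (ν := ν) (l := l) hF hθ) (iSup_le_dualUtility hS)
  have hae := (integral_eq_iff_of_ae_le (integrable_iSup hF hθ hS)
    (integrable_dualUtility (ν := ν) (l := l) hF hθ)
    (ae_of_all _ (iSup_le_dualUtility hS))).1 (le_antisymm heq hge)
  -- At most one exceedance occurs almost surely. Since the exceedance events have total mass one,
  -- their union has full measure, so at least one occurs.
  have hdisj : (S : Set (Fin n)).Pairwise
      (Function.onFun (AEDisjoint θ) fun i => {e | e i ∈ Set.Ioi (l - ν i)}) := by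
    intro i hi j hj hij
    refine measure_eq_zero_iff_ae_notMem.2 (hae.mono fun e heq he => ?_)
    exact hij (eq_of_iSup_eq_dualUtility heq hi hj he.1 he.2)
  have hmeas : ∀ i, MeasurableSet {e : Fin n → ℝ | e i ∈ Set.Ioi (l - ν i)} := fun i =>
    measurable_pi_apply i measurableSet_Ioi
  have hone : θ (⋃ i ∈ S, {e | e i ∈ Set.Ioi (l - ν i)}) = 1 := by
    rw [measure_biUnion_finset₀ hdisj fun i _ => (hmeas i).nullMeasurableSet, ← htail]
    exact Finset.sum_congr rfl fun i _ => measure_preimage_of_mem_jointLaws hθ i measurableSet_Ioi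
  have hex := (prob_compl_eq_zero_iff (S.measurableSet_biUnion fun i _ => hmeas i)).2 hone
  filter_upwards [hae, measure_eq_zero_iff_ae_notMem.1 hex] with e he hmem
  simp only [Set.mem_compl_iff, not_not, Set.mem_iUnion] at hmem
  obtain ⟨i, hi, hie⟩ := hmem
  refine ⟨i, hi, hie, fun j hj hji => ?_⟩
  by_contra hlt
  exact hji (eq_of_iSup_eq_dualUtility he hj hi (not_le.1 hlt) hie)

end Dual

/-! ## Representability -/

section Representability

open Filter Topology

variable {n : ℕ} {F : Fin n → Measure ℝ} {ν : Fin n → ℝ} {S : Finset (Fin n)}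
  {𝒮 : Finset (Finset (Fin n))} {p : Fin n → Finset (Fin n) → ℝ}

/-- With at least two products, the dual problem has a critical point. -/
theorem exists_sum_tail_eq_one (hF : ∀ i, IsAdmissibleMarginal (F i)) (ν : Fin n → ℝ)
    (hS : 1 < S.card) : ∃ l, ∑ i ∈ S, (1 - cdf (F i) (l - ν i)) = 1 := by
  have hcont : Continuous fun l => ∑ i ∈ S, (1 - cdf (F i) (l - ν i)) :=
    continuous_finsetSum _ fun i _ => continuous_const.sub
      ((hF i).continuous_cdf.comp (continuous_id.sub continuous_const))
  have hbot : Tendsto (fun l => ∑ i ∈ S, (1 - cdf (F i) (l - ν i))) atBot (𝓝 (S.card : ℝ)) := by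
    have h : Tendsto (fun l => ∑ i ∈ S, (1 - cdf (F i) (l - ν i))) atBot
        (𝓝 (∑ i ∈ S, (1 - 0 : ℝ))) :=
      tendsto_finsetSum _ fun i _ => tendsto_const_nhds.sub
        ((tendsto_cdf_atBot (F i)).comp (tendsto_atBot_add_const_right _ (-ν i) tendsto_id))
    simpa using h
  have htop : Tendsto (fun l => ∑ i ∈ S, (1 - cdf (F i) (l - ν i))) atTop (𝓝 0) := by
    have h : Tendsto (fun l => ∑ i ∈ S, (1 - cdf (F i) (l - ν i))) atTop
        (𝓝 (∑ i ∈ S, (1 - 1 : ℝ))) :=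
      tendsto_finsetSum _ fun i _ => tendsto_const_nhds.sub
        ((tendsto_cdf_atTop (F i)).comp (tendsto_atTop_add_const_right _ (-ν i) tendsto_id))
    simpa using h
  -- The sum of tails falls from `S.card > 1` to zero. For a singleton, one is only the limit at
  -- `-∞` and may not be attained.
  obtain ⟨a, ha⟩ := (htop.eventually_lt_const one_pos).exists
  obtain ⟨b, hb⟩ := (hbot.eventually_const_lt (u := (1 : ℝ)) (by exact_mod_cast hS)).exists
  exact mem_range_of_exists_le_of_exists_ge hcont ⟨a, ha.le⟩ ⟨b, hb.le⟩

theorem IsChoiceData.le_one (hp : IsChoiceData 𝒮 p) (hS : S ∈ 𝒮) {i : Fin n} (hi : i ∈ S) :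
    p i S ≤ 1 := by
  rw [← (hp S hS).2]
  exact Finset.single_le_sum (f := fun i => p i S) (hp S hS).1 hi

theorem IsChoiceData.nonempty (hp : IsChoiceData 𝒮 p) (hS : S ∈ 𝒮) : S.Nonempty := by
  rw [Finset.nonempty_iff_ne_empty]
  rintro rfl
  simpa using (hp ∅ hS).2

/-- The thresholds at which no tail probability of a product in `S` is below its choice
probability. -/
def lowThresholds (F : Fin n → Measure ℝ) (ν : Fin n → ℝ) (p : Fin n → Finset (Fin n) → ℝ)
    (S : Finset (Fin n)) : Set ℝ :=
  {x | ∀ i ∈ S, cdf (F i) (x - ν i) ≤ 1 - p i S}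

/-- For data represented by a marginal distribution model, the low thresholds are determined by any
product chosen with positive probability. -/
theorem lowThresholds_eq (hF : ∀ i, IsAdmissibleMarginal (F i)) (hp : IsChoiceData 𝒮 p)
    (hS : S ∈ 𝒮)
    (hrep : (∃ l, ∀ i ∈ S, cdf (F i) (l - ν i) = 1 - p i S) ∨ ∃ j, S = {j})
    {i : Fin n} (hi : i ∈ S) (hpos : 0 < p i S) :
    lowThresholds F ν p S = {x | cdf (F i) (x - ν i) ≤ 1 - p i S} := by
  refine Set.Subset.antisymm (fun x hx => hx i hi) fun x hx j hj => ?_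
  -- If `p i S < 1`, strict growth at `l` forces `x ≤ l`, and `l` is low for every product. If `p i
  -- S = 1`, the other products have probability zero and impose nothing.
  rcases hrep with ⟨l, hl⟩ | ⟨k, rfl⟩
  · rcases (hp.le_one hS hi).lt_or_eq with h1 | h1
    · have hxl : x ≤ l := by
        by_contra hlt
        have := (hF i).cdf_lt_cdf (sub_lt_sub_right (not_le.1 hlt) (ν i))
          (by rw [hl i hi]; linarith) (by rw [hl i hi]; linarith)
        rw [hl i hi] at this
        exact not_lt.2 hx this
      exact (monotone_cdf (F j) (sub_le_sub_right hxl (ν j))).trans (hl j hj).le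
    · by_cases hji : j = i
      · exact hji ▸ hx
      · have h2 : p j S + p i S ≤ 1 := by
          rw [← (hp S hS).2, ← Finset.sum_pair hji (f := fun i => p i S)]
          exact Finset.sum_le_sum_of_subset_of_nonneg
            (by simp [Finset.insert_subset_iff, hi, hj]) fun k hk _ => (hp S hS).1 k hk
        linarith [cdf_le_one (F j) (x - ν j)]
  · rw [Finset.mem_singleton] at hi hj
    exact (hj.trans hi.symm) ▸ hx

/-- Choice probabilities with more than one alternative are tail probabilities at a common
threshold. -/
theorem exists_cdf_eq_or_singleton (hF : ∀ i, IsAdmissibleMarginal (F i)) (hS : S.Nonempty)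
    {θ : Measure (Fin n → ℝ)} (hθ : θ ∈ jointLaws F)
    (hmax : IsMaxOn (expectedMaxUtility ν S) (jointLaws F) θ)
    (hc : ∀ i ∈ S, p i S = choiceProb ν S θ i) :
    (∃ l, ∀ i ∈ S, cdf (F i) (l - ν i) = 1 - p i S) ∨ ∃ j, S = {j} := by
  rcases (Nat.succ_le_of_lt hS.card_pos).lt_or_eq with h | h
  · obtain ⟨l, hl⟩ := exists_sum_tail_eq_one hF ν h
    have := fun i => (hF i).isProbabilityMeasure
    refine Or.inl ⟨l, fun i hi => ?_⟩
    rw [hc i hi, choiceProb_eq_of_uniqueExceedance hθ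
      (uniqueExceedance_of_isMaxOn hF hl hθ hmax) hi]
    ring
  · exact Or.inr (Finset.card_eq_one.1 h.symm)

theorem MDMRepresentable.exists_orderCompatible (hp : IsChoiceData 𝒮 p)
    (h : MDMRepresentable 𝒮 p) : ∃ lam, OrderCompatible 𝒮 p lam := by
  obtain ⟨F, ν, hF, h⟩ := h
  have hrep : ∀ S : 𝒮,
      (∃ l, ∀ i ∈ S.1, cdf (F i) (l - ν i) = 1 - p i S.1) ∨ ∃ j, S.1 = {j} := fun S => by
    obtain ⟨θ, hθ, hmax, hc⟩ := h S.1 S.2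
    exact exists_cdf_eq_or_singleton hF (hp.nonempty S.2) hθ hmax hc
  classical
  let L : 𝒮 → Set ℝ := fun S => lowThresholds F ν p S.1
  -- A supremum of `L S` could be `-∞` for a singleton; counting the sets strictly inside `L S`
  -- keeps `lam` real, respects strict inclusion and depends on `L S` alone.
  let rank : 𝒮 → Finset 𝒮 := fun S => Finset.univ.filter fun R => L R ⊂ L S
  refine ⟨fun S => (rank S).card, fun S T i hS hT => ⟨fun hlt => ?_, fun heq hne => ?_⟩⟩
  · have hT1 := hp.le_one T.2 hT
    have hTS : L T ⊂ L S := by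
      rcases hrep S with ⟨l, hl⟩ | ⟨j, hj⟩
      · refine ⟨fun x hx j hj => ?_, fun hsub => ?_⟩
        · have hxl : x ≤ l := by
            by_contra hle
            have h1 := monotone_cdf (F i) (sub_le_sub_right (not_le.1 hle).le (ν i))
            have h2 := hx i hT
            rw [hl i hS] at h1
            linarith
          exact (monotone_cdf (F j) (sub_le_sub_right hxl (ν j))).trans (hl j hj).le
        · have h1 := hsub (show l ∈ L S from fun j hj => (hl j hj).le) i hT
          rw [hl i hS] at h1
          linarith
      -- A singleton is chosen with probability one, so `p i S` cannot be the smaller value.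
      · have h1 := (hp S.1 S.2).2
        have hij : i = j := by rw [hj] at hS; simpa using hS
        have h2 : ∑ k ∈ S.1, p k S.1 = p i S.1 :=
          Finset.sum_eq_single_of_mem i hS fun k hk hki => by
            rw [hj, Finset.mem_singleton, ← hij] at hk
            exact absurd hk hki
        linarith
    have hrank : rank T ⊂ rank S := by
      refine Finset.ssubset_iff_subset_ne.2 ⟨fun R hR => ?_, fun he => ?_⟩
      · simp only [rank, Finset.mem_filter, Finset.mem_univ, true_and] at hR ⊢
        exact hR.trans hTS
      · have : T ∈ rank S := by simpa [rank] using hTS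
        rw [← he] at this
        simp [rank] at this
    exact Nat.cast_lt.2 (Finset.card_lt_card hrank)
  · have hpos : 0 < p i S.1 := lt_of_le_of_ne ((hp S.1 S.2).1 i hS) hne.symm
    have hL : L S = L T := by
      simp only [L]
      rw [lowThresholds_eq hF hp S.2 (hrep S) hS hpos,
        lowThresholds_eq hF hp T.2 (hrep T) hT (heq ▸ hpos), heq]
    simp only [rank, hL]

/-- An order-compatible assignment of thresholds is realized by admissible marginals. -/
theorem OrderCompatible.exists_marginal (hp : IsChoiceData 𝒮 p) {lam : 𝒮 → ℝ}
    (h : OrderCompatible 𝒮 p lam) (i : Fin n) :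
    ∃ μ : Measure ℝ, IsAdmissibleMarginal μ ∧
      ∀ S : 𝒮, i ∈ S.1 → cdf μ (lam S) = 1 - p i S.1 := by
  classical
  have hnn : ∀ S : 𝒮, i ∈ S.1 → 0 ≤ p i S.1 := fun S hS => (hp S.1 S.2).1 i hS
  let A : Finset 𝒮 := Finset.univ.filter fun S => i ∈ S.1 ∧ p i S.1 ≠ 0
  let B : Finset 𝒮 := Finset.univ.filter fun S => i ∈ S.1 ∧ p i S.1 = 0
  have hA : ∀ S, S ∈ A ↔ i ∈ S.1 ∧ p i S.1 ≠ 0 := fun S => by simp [A]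
  have hB : ∀ S, S ∈ B ↔ i ∈ S.1 ∧ p i S.1 = 0 := fun S => by simp [B]
  have hanti : ∀ S ∈ A, ∀ T ∈ A, lam S < lam T → p i T.1 < p i S.1 := by
    intro S hS T hT hlt
    rw [hA] at hS hT
    rcases lt_trichotomy (p i T.1) (p i S.1) with h1 | h1 | h1
    · exact h1
    · exact absurd ((h T S i hT.1 hS.1).2 h1 hT.2) hlt.ne'
    · exact absurd ((h S T i hS.1 hT.1).1 h1) (lt_asymm hlt)
  have hinj : ∀ S ∈ A, ∀ T ∈ A, lam S = lam T → p i S.1 = p i T.1 := by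
    intro S hS T hT heq
    rw [hA] at hS hT
    rcases lt_trichotomy (p i S.1) (p i T.1) with h1 | h1 | h1
    · exact absurd heq ((h S T i hS.1 hT.1).1 h1).ne'
    · exact h1
    · exact absurd heq ((h T S i hT.1 hS.1).1 h1).ne
  -- Positive-probability assortments lie strictly below the zero ones. The distribution function is
  -- made to reach one at `b` in between, which settles all of `B` by monotonicity.
  obtain ⟨b, hbA, hbB⟩ : ∃ b, (∀ x ∈ A.image lam, x < b) ∧ ∀ y ∈ B.image lam, b < y := by
    refine Order.exists_between_finsets (A.image lam) (B.image lam) ?_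
    simp only [Finset.mem_image, forall_exists_index, and_imp]
    rintro _ S hS rfl _ T hT rfl
    rw [hA] at hS
    rw [hB] at hT
    exact (h T S i hT.1 hS.1).1 (hT.2 ▸ lt_of_le_of_ne (hnn S hS.1) hS.2.symm)
  -- By `hinj`, the probability on `A` is a function of the threshold.
  obtain ⟨g, hg⟩ : ∃ g : ℝ → ℝ, ∀ S ∈ A, g (lam S) = p i S.1 := by
    refine ⟨fun x => if hx : ∃ S ∈ A, lam S = x then p i hx.choose.1 else 0, fun S hS => ?_⟩
    have hx : ∃ T ∈ A, lam T = lam S := ⟨S, hS, rfl⟩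
    refine (dif_pos hx).trans ?_
    exact hinj _ hx.choose_spec.1 S hS hx.choose_spec.2
  let G : ℝ → ℝ := fun x => if x = b then 1 else 1 - g x
  have hGA : ∀ S ∈ A, G (lam S) = 1 - p i S.1 := fun S hS => by
    simp only [G]
    rw [if_neg (hbA _ (Finset.mem_image_of_mem lam hS)).ne, hg S hS]
  have hGb : G b = 1 := if_pos rfl
  have hmono : StrictMonoOn G (insert b (A.image lam) : Finset ℝ) := by
    intro x hx y hy hxy
    simp only [Finset.coe_insert, Set.mem_insert_iff, Finset.mem_coe] at hx hy
    rcases hx with rfl | hx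
    · rcases hy with rfl | hy
      · exact absurd hxy (lt_irrefl _)
      · exact absurd hxy (lt_asymm (hbA y hy))
    · obtain ⟨S, hS, rfl⟩ := Finset.mem_image.1 hx
      rw [hGA S hS]
      rcases hy with rfl | hy
      · have := (hA S).1 hS
        have := lt_of_le_of_ne (hnn S this.1) this.2.symm
        rw [hGb]
        linarith
      · obtain ⟨T, hT, rfl⟩ := Finset.mem_image.1 hy
        rw [hGA T hT]
        linarith [hanti S hS T hT hxy]
  obtain ⟨μ, hμ, hcdf⟩ := exists_isAdmissibleMarginal_cdf_eq (insert b (A.image lam)) G hmono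
    (by
      intro x hx
      rcases Finset.mem_insert.1 hx with rfl | hx
      · rw [hGb]; exact zero_le_one
      · obtain ⟨S, hS, rfl⟩ := Finset.mem_image.1 hx
        rw [hGA S hS]
        linarith [hp.le_one S.2 ((hA S).1 hS).1])
    (Finset.mem_insert_self _ _) hGb
    (by
      intro x hx
      rcases Finset.mem_insert.1 hx with rfl | hx
      · exact le_rfl
      · exact (hbA x hx).le)
  refine ⟨μ, hμ, fun S hS => ?_⟩
  by_cases h0 : p i S.1 = 0
  · have h1 := monotone_cdf μ (hbB _ (Finset.mem_image_of_mem lam ((hB S).2 ⟨hS, h0⟩))).le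
    rw [hcdf b (Finset.mem_insert_self _ _), hGb] at h1
    rw [h0, sub_zero]
    exact le_antisymm (cdf_le_one _ _) h1
  · have hSA := (hA S).2 ⟨hS, h0⟩
    rw [hcdf _ (Finset.mem_insert_of_mem (Finset.mem_image_of_mem lam hSA)), hGA S hSA]

theorem OrderCompatible.mdmRepresentable (hp : IsChoiceData 𝒮 p) {lam : 𝒮 → ℝ}
    (h : OrderCompatible 𝒮 p lam) : MDMRepresentable 𝒮 p := by
  choose F hF hcdf using h.exists_marginal hp
  -- Deterministic utilities only shift the marginals, so they can be taken to be zero.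
  refine ⟨F, 0, hF, fun S hS => ?_⟩
  have := fun i => (hF i).isProbabilityMeasure
  have htail : ∀ i ∈ S, 1 - cdf (F i) (lam ⟨S, hS⟩ - (0 : Fin n → ℝ) i) = p i S := fun i hi => by
    rw [Pi.zero_apply, sub_zero, hcdf i ⟨S, hS⟩ hi, sub_sub_cancel]
  have hsum : ∑ i ∈ S, (1 - cdf (F i) (lam ⟨S, hS⟩ - (0 : Fin n → ℝ) i)) = 1 := by
    rw [Finset.sum_congr rfl htail, (hp S hS).2]
  obtain ⟨θ, hθ, hu⟩ := exists_jointLaw_uniqueExceedance (sum_measure_Ioi_eq_one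
    (t := fun i => lam ⟨S, hS⟩ - (0 : Fin n → ℝ) i) hsum)
  refine ⟨θ, hθ, isMaxOn_of_uniqueExceedance hF (hp.nonempty hS) hθ hu, fun i hi => ?_⟩
  rw [choiceProb_eq_of_uniqueExceedance hθ hu hi, htail i hi]

theorem mdmRepresentable_iff_exists_orderCompatible (hp : IsChoiceData 𝒮 p) :
    MDMRepresentable 𝒮 p ↔ ∃ lam, OrderCompatible 𝒮 p lam :=
  ⟨fun h => h.exists_orderCompatible hp, fun ⟨_, h⟩ => h.mdmRepresentable hp⟩

end Representability

end

theorem theorem1 (n : ℕ) (𝒮 : Finset (Finset (Fin n))) (p : Fin n → Finset (Fin n) → ℝ)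
    (hp : IsChoiceData 𝒮 p) :
    (MDMRepresentable 𝒮 p ↔
      ∃ lam : 𝒮 → ℝ, ∀ (S T : 𝒮) (i : Fin n), i ∈ S.1 → i ∈ T.1 →
        (p i S.1 < p i T.1 → lam T < lam S) ∧
        (p i S.1 = p i T.1 → p i S.1 ≠ 0 → lam S = lam T)) ∧
    (MDMRepresentable 𝒮 p ↔ 0 < (mdmProgram 𝒮 p).optimalValue) ∧
    (mdmProgram 𝒮 p).numVariables = 𝒮.card + 1 ∧
    (mdmProgram 𝒮 p).numConstraints ≤ n * 𝒮.card :=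
  have h := mdmRepresentable_iff_exists_orderCompatible hp
  ⟨h, h.trans (exists_orderCompatible_iff_optimalValue_pos hp), numVariables_mdmProgram,
    numConstraints_mdmProgram_le⟩
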